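/- Let $(X,d)$ be a proper, connected, geodesic metric space with $k\in\mathbb N\cup\{\infty\}$ ends. Here an end of $X$ is an equivalence class of proper rays $r\colon[0,\infty)\to X$, where $r\sim r'$ if for every compact $K\subset X$ there is $T$ such that $r([T,\infty))$ and $r'([T,\infty))$ lie in the same path component of $X\setminus K$. A coarsening sequence of $X$ is a sequence of locally finite open coverings $\mathcal U_0,\mathcal U_1,\dots$ such that the members of $\mathcal U_n$ have diameter at most $R_n$, the Lebesgue number of $\mathcal U_{n+1}$ is at least $R_n$, and $R_n\to\infty$, together with a fixed choice, for each member of $\mathcal U_n$, of a member of $\mathcal U_{n+1}$ containing it. These choices induce proper maps of the geometric realizations of the nerves $|\mathcal U_n|\to|\mathcal U_{n+1}|$, and the coarse homology of $X$ is $HX_q(X;\mathbb Z)=\varinjlim_n H_q^{\mathrm{lf}}(|\mathcal U_n|;\mathbb Z)$, where $H^{\mathrm{lf}}_*$ denotes locally finite singular homology. Then, for every coarsening sequence of $X$, the group $HX_1(X;\mathbb Z)$ contains a subgroup isomorphic to $\bigoplus_{j=1}^{k-1}\mathbb Z$ (the trivial group if $k\le 1$, a direct sum of countably infinitely many copies of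 $\mathbb Z$ if $k=\infty$). Such a subgroup is generated by differences of rays to distinct ends: there are proper rays $(r_j)_{0\le j<k}$ in $X$ with a common initial point that define pairwise distinct ends, and for all such rays the following holds. Regard $r_j$ as the locally finite $1$-chain $\sum_{m\ge 0} r_j|_{[m,m+1]}$, so that $r_{j+1}-r_j$ is a locally finite $1$-cycle in $X$. Let $c\colon H_1^{\mathrm{lf}}(X;\mathbb Z)\to HX_1(X;\mathbb Z)$ be the homomorphism induced by the proper map $X\to|\mathcal U_n|$ given by any partition of unity subordinate to any $\mathcal U_n$. Then the classes $c([r_{j+1}-r_j])$, $0\le j<j+1<k$, are linearly independent over $\mathbb Z$, and hence freely generate a subgroup isomorphic to $\bigoplus_{j=1}^{k-1}\mathbb Z$. -/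

import Mathlib

open Set Filter Topology
open scoped NNReal

universe u

noncomputable section

namespace CoarseHomology

/-! ### Push-forward of infinite chains along maps of simplices -/

/-- The push-forward of a formal sum `∑ α σ • σ` along `Φ`: the coefficient of `τ` is the sum of
the coefficients of all `σ` with `Φ σ = τ`. -/
def push {S T : Type*} (Φ : S → T) (α : S → ℤ) : T → ℤ :=
  fun τ => ∑ᶠ σ ∈ {σ : S | Φ σ = τ}, α σ

/-- Only finitely many terms of the formal sum `α` lie over each `τ`. -/
def FiberFinite {S T : Type*} (Φ : S → T) (α : S → ℤ) : Prop :=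
  ∀ τ, ({σ : S | Φ σ = τ} ∩ Function.support α).Finite

theorem push_zero {S T : Type*} (Φ : S → T) : push Φ (0 : S → ℤ) = 0 := by
  funext τ
  simp [push]

theorem push_add {S T : Type*} {Φ : S → T} {α β : S → ℤ}
    (hα : FiberFinite Φ α) (hβ : FiberFinite Φ β) :
    push Φ (α + β) = push Φ α + push Φ β := by
  funext τ
  exact finsum_mem_add_distrib' (hα τ) (hβ τ)

theorem push_comp {S T W : Type*} (Φ : S → T) (Ψ : T → W) (α : S → ℤ)
    (h : FiberFinite (Ψ ∘ Φ) α) : push Ψ (push Φ α) = push (Ψ ∘ Φ) α := by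
  classical
  funext ω
  set F : Finset S := (h ω).toFinset with hF
  have hmem : ∀ σ, σ ∈ F ↔ Ψ (Φ σ) = ω ∧ α σ ≠ 0 := by
    intro σ
    simp [hF]
  have h1 : push (Ψ ∘ Φ) α ω = ∑ σ ∈ F, α σ := finsum_mem_eq_sum _ (h ω)
  have h2 : ∀ τ, Ψ τ = ω → push Φ α τ = ∑ σ ∈ F with Φ σ = τ, α σ := by
    intro τ hτ
    refine finsum_mem_eq_sum_of_inter_support_eq _ ?_
    ext σ
    simp only [Set.mem_inter_iff, Set.mem_ofPred_eq, Function.mem_support, Finset.coe_filter, hmem]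
    constructor
    · rintro ⟨rfl, h0⟩
      exact ⟨⟨⟨hτ, h0⟩, rfl⟩, h0⟩
    · rintro ⟨⟨_, h3⟩, h0⟩
      exact ⟨h3, h0⟩
  rw [h1, ← Finset.sum_fiberwise_of_maps_to (t := F.image Φ) (g := Φ)
    (fun σ hσ => Finset.mem_image_of_mem _ hσ)]
  have h3 : push Ψ (push Φ α) ω = ∑ τ ∈ F.image Φ, push Φ α τ := by
    refine finsum_mem_eq_sum_of_inter_support_eq _ ?_
    ext τ
    simp only [Set.mem_inter_iff, Set.mem_ofPred_eq, Function.mem_support, Finset.coe_image,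
      Set.mem_image, Finset.mem_coe]
    constructor
    · rintro ⟨hτ, h0⟩
      refine ⟨?_, h0⟩
      rw [h2 τ hτ] at h0
      obtain ⟨σ, hσ, -⟩ := Finset.exists_ne_zero_of_sum_ne_zero h0
      rw [Finset.mem_filter] at hσ
      exact ⟨σ, hσ.1, hσ.2⟩
    · rintro ⟨⟨σ, hσ, rfl⟩, h0⟩
      exact ⟨((hmem σ).1 hσ).1, h0⟩
  rw [h3]
  refine Finset.sum_congr rfl fun τ hτ => ?_
  obtain ⟨σ, hσ, rfl⟩ := Finset.mem_image.1 hτ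
  exact h2 _ ((hmem σ).1 hσ).1

/-! ### Locally finite singular homology -/

/-- Singular `n`-simplices of `Z`. -/
abbrev SingularSimplex (n : ℕ) (Z : Type*) [TopologicalSpace Z] : Type _ :=
  C(stdSimplex ℝ (Fin (n + 1)), Z)

/-- A possibly infinite formal sum of singular simplices is locally finite if every compact set
meets only finitely many of the simplices with nonzero coefficient. -/
def IsLocallyFinite {n : ℕ} {Z : Type*} [TopologicalSpace Z] (α : SingularSimplex n Z → ℤ) : Prop :=
  ∀ K : Set Z, IsCompact K → {σ | α σ ≠ 0 ∧ (range σ ∩ K).Nonempty}.Finite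

/-- The group of locally finite singular `n`-chains with integer coefficients. -/
def LFChain (n : ℕ) (Z : Type*) [TopologicalSpace Z] : AddSubgroup (SingularSimplex n Z → ℤ) where
  carrier := {α | IsLocallyFinite α}
  zero_mem' := by
    intro K _
    simp
  add_mem' := by
    intro α β hα hβ K hK
    refine ((hα K hK).union (hβ K hK)).subset ?_
    rintro σ ⟨h, hσ⟩
    by_cases h0 : α σ = 0
    · exact Or.inr ⟨fun h1 => h (by simp [h0, h1]), hσ⟩
    · exact Or.inl ⟨h0, hσ⟩
  neg_mem' := by
    intro α hα K hK
    refine (hα K hK).subset ?_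
    rintro σ ⟨h, hσ⟩
    exact ⟨fun h1 => h (by simp [h1]), hσ⟩

/-- A map of singular simplices is proper if the simplices whose image meets a given compact set
all meet a common compact set. -/
def IsProperOnSimplices {n m : ℕ} {Z W : Type*} [TopologicalSpace Z] [TopologicalSpace W]
    (Φ : SingularSimplex n Z → SingularSimplex m W) : Prop :=
  ∀ K : Set W, IsCompact K → ∃ L : Set Z, IsCompact L ∧
    ∀ σ, (range (Φ σ) ∩ K).Nonempty → (range σ ∩ L).Nonempty

section Push

variable {n m l : ℕ} {Z W V : Type*} [TopologicalSpace Z] [TopologicalSpace W] [TopologicalSpace V]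

theorem IsProperOnSimplices.fiberFinite {Φ : SingularSimplex n Z → SingularSimplex m W}
    (hΦ : IsProperOnSimplices Φ) {α : SingularSimplex n Z → ℤ} (hα : IsLocallyFinite α) :
    FiberFinite Φ α := by
  intro τ
  obtain ⟨L, hL, h⟩ := hΦ (range τ) (isCompact_range τ.continuous)
  refine (hα L hL).subset ?_
  rintro σ ⟨rfl, h0⟩
  refine ⟨h0, h σ ?_⟩
  rw [Set.inter_self]
  exact Set.range_nonempty _

theorem IsProperOnSimplices.push_mem {Φ : SingularSimplex n Z → SingularSimplex m W}
    (hΦ : IsProperOnSimplices Φ) {α : SingularSimplex n Z → ℤ} (hα : IsLocallyFinite α) :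
    IsLocallyFinite (push Φ α) := by
  intro K hK
  obtain ⟨L, hL, h⟩ := hΦ K hK
  refine ((hα L hL).image Φ).subset ?_
  rintro τ ⟨h0, hτ⟩
  obtain ⟨σ, hσ, h1⟩ := exists_ne_zero_of_finsum_mem_ne_zero h0
  subst hσ
  exact ⟨σ, ⟨h1, h σ hτ⟩, rfl⟩

/-- The homomorphism on locally finite chains induced by a proper map of simplices. -/
def pushHom (Φ : SingularSimplex n Z → SingularSimplex m W) (hΦ : IsProperOnSimplices Φ) :
    LFChain n Z →+ LFChain m W where
  toFun α := ⟨push Φ α.1, hΦ.push_mem α.2⟩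
  map_zero' := Subtype.ext (push_zero Φ)
  map_add' α β := Subtype.ext (push_add (hΦ.fiberFinite α.2) (hΦ.fiberFinite β.2))

theorem IsProperOnSimplices.comp {Φ : SingularSimplex n Z → SingularSimplex m W}
    {Ψ : SingularSimplex m W → SingularSimplex l V} (hΨ : IsProperOnSimplices Ψ)
    (hΦ : IsProperOnSimplices Φ) : IsProperOnSimplices (Ψ ∘ Φ) := by
  intro K hK
  obtain ⟨L, hL, h⟩ := hΨ K hK
  obtain ⟨M, hM, h'⟩ := hΦ L hL
  exact ⟨M, hM, fun σ hσ => h' σ (h _ hσ)⟩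

theorem pushHom_pushHom {Φ : SingularSimplex n Z → SingularSimplex m W}
    {Ψ : SingularSimplex m W → SingularSimplex l V} (hΨ : IsProperOnSimplices Ψ)
    (hΦ : IsProperOnSimplices Φ) (α : LFChain n Z) :
    pushHom Ψ hΨ (pushHom Φ hΦ α) = pushHom (Ψ ∘ Φ) (hΨ.comp hΦ) α :=
  Subtype.ext (push_comp Φ Ψ α.1 ((hΨ.comp hΦ).fiberFinite α.2))

/-- The `i`-th face of a singular simplex. -/
def face (i : Fin (n + 2)) (σ : SingularSimplex (n + 1) Z) : SingularSimplex n Z :=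
  σ.comp ⟨stdSimplex.map i.succAbove, stdSimplex.continuous_map _⟩

theorem isProperOnSimplices_face (i : Fin (n + 2)) :
    IsProperOnSimplices (face i : SingularSimplex (n + 1) Z → SingularSimplex n Z) := by
  intro K hK
  refine ⟨K, hK, ?_⟩
  rintro σ ⟨_, ⟨t, rfl⟩, ht⟩
  exact ⟨_, ⟨stdSimplex.map i.succAbove t, rfl⟩, ht⟩

/-- The boundary operator `∑ i, (-1) ^ i • dᵢ` on locally finite chains. -/
def boundary (n : ℕ) (Z : Type*) [TopologicalSpace Z] : LFChain (n + 1) Z →+ LFChain n Z :=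
  ∑ i : Fin (n + 2), (-1 : ℤ) ^ (i : ℕ) • pushHom (face i) (isProperOnSimplices_face i)

/-- Locally finite `n`-cycles; every `0`-chain is a cycle. -/
def cycles : (n : ℕ) → (Z : Type*) → [TopologicalSpace Z] → AddSubgroup (LFChain n Z)
  | 0, _, _ => ⊤
  | n + 1, Z, _ => (boundary n Z).ker

/-- Locally finite singular homology with integer coefficients: cycles modulo boundaries. -/
abbrev LFHomology (n : ℕ) (Z : Type*) [TopologicalSpace Z] : Type _ :=
  cycles n Z ⧸ (boundary n Z).range.addSubgroupOf (cycles n Z)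

/-- Composition of simplices with a continuous proper map. -/
def postcomp (n : ℕ) (f : CocompactMap Z W) (σ : SingularSimplex n Z) : SingularSimplex n W :=
  (f : C(Z, W)).comp σ

theorem isProperOnSimplices_postcomp (n : ℕ) (f : CocompactMap Z W) :
    IsProperOnSimplices (postcomp n f) := by
  intro K hK
  have h : f ⁻¹' Kᶜ ∈ cocompact Z := CocompactMapClass.cocompact_tendsto f hK.compl_mem_cocompact
  obtain ⟨L, hL, hLK⟩ := mem_cocompact.1 h
  refine ⟨L, hL, ?_⟩
  rintro σ ⟨_, ⟨t, rfl⟩, ht⟩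
  refine ⟨σ t, ⟨t, rfl⟩, ?_⟩
  by_contra hσ
  exact hLK hσ ht

/-- The chain map induced by a continuous proper map. -/
def chainMap (n : ℕ) (f : CocompactMap Z W) : LFChain n Z →+ LFChain n W :=
  pushHom (postcomp n f) (isProperOnSimplices_postcomp n f)

theorem boundary_chainMap (f : CocompactMap Z W) (α : LFChain (n + 1) Z) :
    boundary n W (chainMap (n + 1) f α) = chainMap n f (boundary n Z α) := by
  simp only [boundary, AddMonoidHom.finsetSum_apply, AddMonoidHom.smul_apply, map_sum, map_zsmul,
    chainMap, pushHom_pushHom]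
  rfl

theorem chainMap_mem_cycles (n : ℕ) (f : CocompactMap Z W) (α : LFChain n Z)
    (hα : α ∈ cycles n Z) : chainMap n f α ∈ cycles n W := by
  cases n with
  | zero => exact AddSubgroup.mem_top _
  | succ n =>
    have h : boundary n Z α = 0 := hα
    change boundary n W (chainMap (n + 1) f α) = 0
    rw [boundary_chainMap, h, map_zero]

/-- The map on cycles induced by a continuous proper map. -/
def cyclesMap (n : ℕ) (f : CocompactMap Z W) : cycles n Z →+ cycles n W :=
  ((chainMap n f).comp (cycles n Z).subtype).codRestrict (cycles n W)
    fun α => chainMap_mem_cycles n f α.1 α.2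

/-- The map on locally finite homology induced by a continuous proper map. -/
def LFHomology.map (n : ℕ) (f : CocompactMap Z W) : LFHomology n Z →+ LFHomology n W :=
  QuotientAddGroup.map _ _ (cyclesMap n f) (by
    rintro ⟨α, hα⟩ ⟨β, hβ⟩
    exact ⟨chainMap (n + 1) f β, by rw [boundary_chainMap, hβ]; rfl⟩)

end Push

/-! ### Nerves of locally finite coverings -/

/-- A locally finite covering of a metric space by bounded open sets. -/
structure BoundedCover (X : Type*) [MetricSpace X] (ι : Type*) where
  /-- the members of the covering -/
  U : ι → Set X
  isOpen : ∀ i, IsOpen (U i)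
  isBounded : ∀ i, Bornology.IsBounded (U i)
  locallyFinite : LocallyFinite U
  iUnion_eq : ⋃ i, U i = univ

section Nerve

variable {X ι κ : Type*} [MetricSpace X]

/-- The geometric realization of the nerve of a covering, in barycentric coordinates: a point is a
finite convex combination of indices `i` for which the sets `U i` have a common point. -/
structure Nerve (𝒰 : BoundedCover X ι) where
  /-- the barycentric coordinates -/
  coord : ι →₀ ℝ
  nonneg : ∀ i, 0 ≤ coord i
  sum_eq_one : ∑ i ∈ coord.support, coord i = 1
  nonempty_inter : (⋂ i ∈ coord.support, 𝒰.U i).Nonempty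

/-- The topology is that of convergence of all barycentric coordinates. For a covering as above
of a proper space the nerve is a locally finite complex, and this is its weak topology. -/
instance (𝒰 : BoundedCover X ι) : TopologicalSpace (Nerve 𝒰) :=
  TopologicalSpace.induced (fun t => (⇑t.coord : ι → ℝ)) inferInstance

namespace Nerve

variable {𝒰 : BoundedCover X ι} {𝒱 : BoundedCover X κ}

theorem continuous_coord (i : ι) : Continuous fun t : Nerve 𝒰 => t.coord i :=
  (continuous_apply i).comp continuous_induced_dom

theorem coord_le_one (t : Nerve 𝒰) (i : ι) : t.coord i ≤ 1 := by
  by_cases hi : i ∈ t.coord.support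
  · rw [← t.sum_eq_one]
    exact Finset.single_le_sum (fun j _ => t.nonneg j) hi
  · rw [Finsupp.notMem_support_iff.1 hi]
    exact zero_le_one

theorem exists_mem_support (t : Nerve 𝒰) : ∃ i, i ∈ t.coord.support := by
  by_contra h
  have h0 : t.coord.support = ∅ := Finset.eq_empty_of_forall_notMem fun i hi => h ⟨i, hi⟩
  have h1 := t.sum_eq_one
  rw [h0, Finset.sum_empty] at h1
  exact zero_ne_one h1

theorem exists_finset_of_isCompact {K : Set (Nerve 𝒰)} (hK : IsCompact K) :
    ∃ F : Finset ι, ∀ t ∈ K, ∃ i ∈ F, i ∈ t.coord.support := by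
  obtain ⟨F, hF⟩ := hK.elim_finite_subcover (fun i => {t : Nerve 𝒰 | t.coord i ≠ 0})
    (fun i => isOpen_ne.preimage (continuous_coord i)) (by
      intro t _
      obtain ⟨i, hi⟩ := t.exists_mem_support
      exact mem_iUnion.2 ⟨i, Finsupp.mem_support_iff.1 hi⟩)
  refine ⟨F, fun t ht => ?_⟩
  obtain ⟨i, hi, h⟩ := mem_iUnion₂.1 (hF ht)
  exact ⟨i, hi, Finsupp.mem_support_iff.2 h⟩

theorem isCompact_support_subset (𝒰 : BoundedCover X ι) (B : Finset ι) :
    IsCompact {t : Nerve 𝒰 | t.coord.support ⊆ B} := by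
  classical
  have hind : IsInducing (fun t : Nerve 𝒰 => (⇑t.coord : ι → ℝ)) := ⟨rfl⟩
  rw [hind.isCompact_iff]
  have himg : (fun t : Nerve 𝒰 => (⇑t.coord : ι → ℝ)) '' {t | t.coord.support ⊆ B} =
      ⋃ τ ∈ {τ : Finset ι | τ ∈ B.powerset ∧ (⋂ i ∈ τ, 𝒰.U i).Nonempty},
        {s : ι → ℝ | (∀ i, s i ∈ Icc (0 : ℝ) 1) ∧ (∀ i ∉ τ, s i = 0) ∧ ∑ i ∈ τ, s i = 1} := by
    ext s
    simp only [Set.mem_image, Set.mem_iUnion, Set.mem_ofPred_eq, Finset.mem_powerset, exists_prop]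
    constructor
    · rintro ⟨t, ht, rfl⟩
      exact ⟨t.coord.support, ⟨ht, t.nonempty_inter⟩, fun i => ⟨t.nonneg i, t.coord_le_one i⟩,
        fun i hi => Finsupp.notMem_support_iff.1 hi, t.sum_eq_one⟩
    · rintro ⟨τ, ⟨hτB, x, hx⟩, h01, h0, h1⟩
      have hsub : ∀ i, s i ≠ 0 → i ∈ τ := fun i hi => by
        by_contra h
        exact hi (h0 i h)
      have hsupp : (Finsupp.onFinset τ s hsub).support ⊆ τ := Finsupp.support_onFinset_subset
      refine ⟨⟨Finsupp.onFinset τ s hsub, fun i => (h01 i).1, ?_, x, ?_⟩, hsupp.trans hτB, rfl⟩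
      · rw [← h1]
        refine Finset.sum_subset hsupp fun i _ hi => ?_
        exact Finsupp.notMem_support_iff.1 hi
      · rw [mem_iInter₂] at hx ⊢
        exact fun i hi => hx i (hsupp hi)
  rw [himg]
  refine Set.Finite.isCompact_biUnion ?_ ?_
  · exact (B.powerset.finite_toSet).subset fun τ hτ => hτ.1
  · intro τ _
    refine (isCompact_univ_pi fun _ : ι => isCompact_Icc (a := (0 : ℝ)) (b := 1)).of_isClosed_subset
      ?_ fun s hs i _ => hs.1 i
    refine IsClosed.inter ?_ (IsClosed.inter ?_ ?_)
    · have h : IsClosed (⋂ i, {s : ι → ℝ | s i ∈ Icc (0 : ℝ) 1}) :=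
        isClosed_iInter fun i => isClosed_Icc.preimage (continuous_apply i)
      have e : (⋂ i, {s : ι → ℝ | s i ∈ Icc (0 : ℝ) 1}) = {s | ∀ i, s i ∈ Icc (0 : ℝ) 1} := by
        ext s
        simp
      rw [e] at h
      exact h
    · have h : IsClosed (⋂ i, ⋂ (_ : i ∉ τ), {s : ι → ℝ | s i = 0}) :=
        isClosed_iInter fun i => isClosed_iInter fun _ =>
          isClosed_singleton.preimage (continuous_apply i)
      have e : (⋂ i, ⋂ (_ : i ∉ τ), {s : ι → ℝ | s i = 0}) = {s | ∀ i ∉ τ, s i = 0} := by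
        ext s
        simp
      rw [e] at h
      exact h
    · exact isClosed_singleton.preimage
        (continuous_finsetSum _ fun i _ => continuous_apply i)

theorem finite_inter [ProperSpace X] (𝒰 : BoundedCover X ι) {S : Set X}
    (hS : Bornology.IsBounded S) : {i | (𝒰.U i ∩ S).Nonempty}.Finite :=
  (𝒰.locallyFinite.finite_nonempty_inter_compact hS.isCompact_closure).subset
    fun _ hi => hi.mono (inter_subset_inter_right _ subset_closure)

theorem finite_subset [ProperSpace X] (𝒰 : BoundedCover X ι) {S : Set X}
    (hS : Bornology.IsBounded S) : {i | (𝒰.U i).Nonempty ∧ 𝒰.U i ⊆ S}.Finite :=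
  (finite_inter 𝒰 hS).subset fun _ hi => by
    change (𝒰.U _ ∩ S).Nonempty
    rw [inter_eq_left.2 hi.2]
    exact hi.1

theorem nonempty_of_mem_support (t : Nerve 𝒰) {i : ι} (hi : i ∈ t.coord.support) :
    (𝒰.U i).Nonempty :=
  let ⟨x, hx⟩ := t.nonempty_inter
  ⟨x, mem_iInter₂.1 hx i hi⟩

/-- The affine map of nerves induced by a map `φ` of index sets with `U i ⊆ V (φ i)`. -/
def mapFun (φ : ι → κ) (hφ : ∀ i, 𝒰.U i ⊆ 𝒱.U (φ i)) (t : Nerve 𝒰) : Nerve 𝒱 :=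
  { coord := t.coord.mapDomain φ
    nonneg := by
      classical
      intro k
      rw [Finsupp.mapDomain, Finsupp.sum, Finsupp.finsetSum_apply]
      refine Finset.sum_nonneg fun i _ => ?_
      rw [Finsupp.single_apply]
      split_ifs
      exacts [t.nonneg i, le_rfl]
    sum_eq_one := by
      have h := Finsupp.sum_mapDomain_index (f := φ) (s := t.coord) (h := fun _ (a : ℝ) => a)
        (fun _ => rfl) (fun _ _ _ => rfl)
      exact h.trans t.sum_eq_one
    nonempty_inter := by
      classical
      obtain ⟨x, hx⟩ := t.nonempty_inter
      refine ⟨x, mem_iInter₂.2 fun k hk => ?_⟩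
      obtain ⟨i, hi, rfl⟩ := Finset.mem_image.1 (Finsupp.mapDomain_support hk)
      exact hφ i (mem_iInter₂.1 hx i hi) }

theorem continuous_mapFun [ProperSpace X] (φ : ι → κ) (hφ : ∀ i, 𝒰.U i ⊆ 𝒱.U (φ i)) :
    Continuous (mapFun φ hφ) := by
  classical
  refine continuous_induced_rng.2 (continuous_pi fun k => ?_)
  have hfin : {i | φ i = k ∧ (𝒰.U i).Nonempty}.Finite :=
    (finite_subset 𝒰 (𝒱.isBounded k)).subset fun i hi => ⟨hi.2, hi.1 ▸ hφ i⟩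
  have heq : ∀ t : Nerve 𝒰, (mapFun φ hφ t).coord k = ∑ i ∈ hfin.toFinset, t.coord i := by
    intro t
    change t.coord.mapDomain φ k = _
    rw [Finsupp.mapDomain, Finsupp.sum, Finsupp.finsetSum_apply]
    simp only [Finsupp.single_apply]
    rw [← Finset.sum_filter]
    refine Finset.sum_subset ?_ ?_
    · intro i hi
      rw [Finset.mem_filter] at hi
      exact hfin.mem_toFinset.2 ⟨hi.2, t.nonempty_of_mem_support hi.1⟩
    · intro i hi hi'
      by_contra h0
      exact hi' (Finset.mem_filter.2
        ⟨Finsupp.mem_support_iff.2 h0, (hfin.mem_toFinset.1 hi).1⟩)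
  change Continuous fun t : Nerve 𝒰 => (mapFun φ hφ t).coord k
  simp only [heq]
  exact continuous_finsetSum _ fun i _ => continuous_coord i

/-- The map of nerves induced by a refinement, as a continuous proper map. -/
def map [ProperSpace X] (φ : ι → κ) (hφ : ∀ i, 𝒰.U i ⊆ 𝒱.U (φ i)) :
    CocompactMap (Nerve 𝒰) (Nerve 𝒱) where
  toFun := mapFun φ hφ
  continuous_toFun := continuous_mapFun φ hφ
  cocompact_tendsto' := by
    classical
    intro S hS
    obtain ⟨K, hK, hKS⟩ := mem_cocompact.1 hS
    obtain ⟨F, hF⟩ := exists_finset_of_isCompact hK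
    have hbdd : Bornology.IsBounded (⋃ k ∈ F, 𝒱.U k) :=
      (Bornology.isBounded_biUnion_finset F).2 fun k _ => 𝒱.isBounded k
    have hB := finite_inter 𝒰 hbdd
    refine mem_cocompact.2 ⟨_, isCompact_support_subset 𝒰 hB.toFinset, ?_⟩
    intro t ht
    refine hKS fun htK => ht ?_
    obtain ⟨k, hk, hkt⟩ := hF _ htK
    obtain ⟨i, hi, rfl⟩ := Finset.mem_image.1 (Finsupp.mapDomain_support hkt)
    obtain ⟨x, hx⟩ := t.nonempty_inter
    intro j hj
    exact hB.mem_toFinset.2 ⟨x, mem_iInter₂.1 hx j hj,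
      mem_iUnion₂.2 ⟨φ i, hk, hφ i (mem_iInter₂.1 hx i hi)⟩⟩

/-- The continuous proper map from a proper space to the nerve of a covering whose barycentric
coordinates are the functions of a subordinate partition of unity. -/
def ofPartition [ProperSpace X] (ρ : PartitionOfUnity ι X) (hρ : ρ.IsSubordinate 𝒰.U) :
    CocompactMap X (Nerve 𝒰) where
  toFun x :=
    { coord := Finsupp.ofSupportFinite (fun i => ρ i x) (ρ.locallyFinite.point_finite x)
      nonneg := fun i => ρ.nonneg i x
      sum_eq_one := by
        rw [← ρ.sum_eq_one (mem_univ x)]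
        refine (finsum_eq_sum_of_support_subset (fun i => ρ i x) ?_).symm
        intro i hi
        exact Finsupp.mem_support_iff.2 hi
      nonempty_inter := ⟨x, mem_iInter₂.2 fun i hi =>
        hρ i (subset_tsupport _ (Finsupp.mem_support_iff.1 hi))⟩ }
  continuous_toFun := continuous_induced_rng.2 (continuous_pi fun i => (ρ i).continuous)
  cocompact_tendsto' := by
    intro S hS
    obtain ⟨K, hK, hKS⟩ := mem_cocompact.1 hS
    obtain ⟨F, hF⟩ := exists_finset_of_isCompact hK
    have hbdd : Bornology.IsBounded (⋃ k ∈ F, 𝒰.U k) :=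
      (Bornology.isBounded_biUnion_finset F).2 fun k _ => 𝒰.isBounded k
    refine mem_cocompact.2 ⟨_, hbdd.isCompact_closure, ?_⟩
    intro x hx
    refine hKS fun hxK => hx (subset_closure ?_)
    obtain ⟨k, hk, hkx⟩ := hF _ hxK
    exact mem_iUnion₂.2 ⟨k, hk, hρ k (subset_tsupport _ (Finsupp.mem_support_iff.1 hkx))⟩

end Nerve

end Nerve

/-! ### Coarse homology -/

/-- A coarsening sequence of a metric space `X`: locally finite open coverings `𝒰 n` whose members
have diameter at most `R n`, such that the Lebesgue number of `𝒰 (n + 1)` is at least `R n` and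
`R n → ∞`, with a fixed assignment sending each member of `𝒰 n` to a member of `𝒰 (n + 1)`
containing it. -/
structure CoarseningSequence (X : Type*) [MetricSpace X] where
  /-- the index set of the `n`-th covering -/
  ι : ℕ → Type*
  /-- the `n`-th covering -/
  cover : ∀ n, BoundedCover X (ι n)
  /-- the bounds on the diameters -/
  R : ℕ → ℝ
  diam_le : ∀ n i, Metric.diam ((cover n).U i) ≤ R n
  lebesgue : ∀ n (A : Set X), A.Nonempty → Bornology.IsBounded A → Metric.diam A < R n →
    ∃ i, A ⊆ (cover (n + 1)).U i
  tendsto_R : Tendsto R atTop atTop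
  /-- the assignment of members of successive coverings -/
  next : ∀ n, ι n → ι (n + 1)
  subset_next : ∀ n i, (cover n).U i ⊆ (cover (n + 1)).U (next n i)

namespace CoarseningSequence

variable {X : Type*} [MetricSpace X]

/-- The composite of the assignments between stages `n ≤ m`. -/
def assign (C : CoarseningSequence X) {n m : ℕ} (h : n ≤ m) : C.ι n → C.ι m :=
  Nat.leRecOn h fun {k} => C.next k

theorem subset_assign (C : CoarseningSequence X) {n m : ℕ} (h : n ≤ m) (i : C.ι n) :
    (C.cover n).U i ⊆ (C.cover m).U (C.assign h i) := by
  induction m, h using Nat.le_induction with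
  | base => rw [assign, Nat.leRecOn_self]
  | succ m h ih =>
    rw [assign, Nat.leRecOn_succ h]
    exact ih.trans (C.subset_next m _)

variable [ProperSpace X]

/-- The coarsening map between the nerves at stages `n ≤ m`. -/
def coarsen (C : CoarseningSequence X) {n m : ℕ} (h : n ≤ m) :
    CocompactMap (Nerve (C.cover n)) (Nerve (C.cover m)) :=
  Nerve.map (C.assign h) (C.subset_assign h)

/-- The coarse homology `HX_q(X; ℤ)`: the direct limit of the locally finite homology groups of the
nerves of a coarsening sequence. -/
def HX (C : CoarseningSequence X) (q : ℕ) : Type _ :=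
  AddCommGroup.DirectLimit (fun n => LFHomology q (Nerve (C.cover n)))
    (fun _ _ h => LFHomology.map q (C.coarsen h))

instance (C : CoarseningSequence X) (q : ℕ) : AddCommGroup (C.HX q) :=
  AddCommGroup.DirectLimit.addCommGroup (fun n => LFHomology q (Nerve (C.cover n)))
    (fun _ _ h => LFHomology.map q (C.coarsen h))

/-- The canonical homomorphism from the `n`-th stage to the direct limit. -/
def toHX (C : CoarseningSequence X) (q n : ℕ) : LFHomology q (Nerve (C.cover n)) →+ C.HX q :=
  AddCommGroup.DirectLimit.of (fun n => LFHomology q (Nerve (C.cover n)))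
    (fun _ _ h => LFHomology.map q (C.coarsen h)) n

/-- The homomorphism from the locally finite homology of `X` to its coarse homology induced by
the map from `X` to the `n`-th nerve given by a subordinate partition of unity. -/
def fromLF (C : CoarseningSequence X) (q n : ℕ) (ρ : PartitionOfUnity (C.ι n) X)
    (hρ : ρ.IsSubordinate (C.cover n).U) : LFHomology q X →+ C.HX q :=
  (C.toHX q n).comp (LFHomology.map q (Nerve.ofPartition ρ hρ))

end CoarseningSequence

/-- Every proper metric space has a coarsening sequence. -/
theorem CoarseningSequence.nonempty (X : Type u) [MetricSpace X] [ProperSpace X] :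
    Nonempty (CoarseningSequence.{u, u} X) := by
  obtain ⟨V, hVo, hVc, hVl, hVs⟩ := precise_refinement (fun x : X => Metric.ball x (1 / 2))
    (fun _ => Metric.isOpen_ball)
    (eq_univ_of_forall fun x => mem_iUnion.2 ⟨x, Metric.mem_ball_self (by norm_num)⟩)
  have hdist : ∀ i, ∀ x ∈ V i, ∀ y ∈ V i, dist x y ≤ 1 := by
    intro i x hx y hy
    have h1 := Metric.mem_ball.1 (hVs i hx)
    have h2 := Metric.mem_ball'.1 (hVs i hy)
    linarith [dist_triangle x i y]
  set c : ℕ → ℝ := fun n => 2 ^ (n + 1) - 1 with hc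
  have hc1 : ∀ n, 1 ≤ c n := fun n => by
    have := one_le_pow₀ (n := n) (one_le_two (α := ℝ))
    simp only [hc, pow_succ]
    linarith
  have hcs : ∀ n, c (n + 1) = 2 * c n + 1 := fun n => by
    simp only [hc]
    ring
  have hUdist : ∀ n i, ∀ x ∈ Metric.thickening (c n) (V i), ∀ y ∈ Metric.thickening (c n) (V i),
      dist x y ≤ c (n + 1) := by
    intro n i x hx y hy
    obtain ⟨x', hx', h1⟩ := Metric.mem_thickening_iff.1 hx
    obtain ⟨y', hy', h2⟩ := Metric.mem_thickening_iff.1 hy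
    have h3 := hdist i x' hx' y' hy'
    have h4 := dist_triangle4 x x' y' y
    rw [dist_comm y' y] at h4
    rw [hcs]
    linarith
  refine ⟨{
    ι := fun _ => X
    cover := fun n =>
      { U := fun i => Metric.thickening (c n) (V i)
        isOpen := fun i => Metric.isOpen_thickening
        isBounded := fun i => Metric.isBounded_iff.2 ⟨c (n + 1), fun x hx y hy => hUdist n i x hx y hy⟩
        locallyFinite := ?_
        iUnion_eq := ?_ }
    R := fun n => c (n + 1)
    diam_le := fun n i => Metric.diam_le_of_forall_dist_le (by linarith [hc1 (n + 1)]) (hUdist n i)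
    lebesgue := ?_
    tendsto_R := ?_
    next := fun _ i => i
    subset_next := fun n i => Metric.thickening_mono (by linarith [hcs n, hc1 n]) _ }⟩
  · intro x
    refine ⟨Metric.ball x 1, Metric.ball_mem_nhds x one_pos, ?_⟩
    refine (hVl.finite_nonempty_inter_compact (isCompact_closedBall x (c n + 1))).subset ?_
    rintro i ⟨y, hy, hyx⟩
    obtain ⟨z, hz, hyz⟩ := Metric.mem_thickening_iff.1 hy
    refine ⟨z, hz, Metric.mem_closedBall.2 ?_⟩
    have := Metric.mem_ball.1 hyx
    have := dist_triangle z y x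
    rw [dist_comm z y] at this
    linarith
  · refine eq_univ_of_forall fun x => ?_
    obtain ⟨i, hi⟩ := mem_iUnion.1 (hVc.symm ▸ mem_univ x : x ∈ ⋃ i, V i)
    exact mem_iUnion.2 ⟨i, Metric.self_subset_thickening (by linarith [hc1 n]) _ hi⟩
  · rintro n A ⟨a, ha⟩ hA hdiam
    obtain ⟨i, hi⟩ := mem_iUnion.1 (hVc.symm ▸ mem_univ a : a ∈ ⋃ i, V i)
    exact ⟨i, fun x hx => Metric.mem_thickening_iff.2
      ⟨a, hi, (Metric.dist_le_diam_of_mem hA hx ha).trans_lt hdiam⟩⟩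
  · refine tendsto_atTop_mono (f := fun n : ℕ => (n : ℝ)) (fun n => ?_) tendsto_natCast_atTop_atTop
    induction n with
    | zero => simpa using le_trans zero_le_one (hc1 1)
    | succ n ih => push_cast; linarith [hcs (n + 1), hc1 (n + 1)]

/-! ### Ends -/

/-- A metric space is geodesic if any two points are joined by a path parametrized by arc length
whose length is their distance. -/
def IsGeodesic (X : Type*) [MetricSpace X] : Prop :=
  ∀ x y : X, ∃ γ : ℝ → X, γ 0 = x ∧ γ (dist x y) = y ∧
    ∀ s ∈ Icc 0 (dist x y), ∀ t ∈ Icc 0 (dist x y), dist (γ s) (γ t) = |s - t|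

/-- Proper rays `[0, ∞) → X`. -/
abbrev ProperRay (X : Type*) [TopologicalSpace X] : Type _ := CocompactMap ℝ≥0 X

namespace ProperRay

variable {X : Type*} [TopologicalSpace X]

/-- Two proper rays define the same end if outside every compact set `K` their tails lie in the
same path component of the complement of `K`. -/
def SameEnd (r r' : ProperRay X) : Prop :=
  ∀ K : Set X, IsCompact K → ∃ T : ℝ≥0, ∀ s ≥ T, ∀ s' ≥ T, JoinedIn Kᶜ (r s) (r' s')

theorem exists_forall_ge_notMem (r : ProperRay X) {K : Set X} (hK : IsCompact K) :
    ∃ T : ℝ≥0, ∀ s ≥ T, r s ∉ K := by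
  have h : r ⁻¹' Kᶜ ∈ cocompact ℝ≥0 := CocompactMapClass.cocompact_tendsto r hK.compl_mem_cocompact
  obtain ⟨L, hL, hLK⟩ := mem_cocompact.1 h
  obtain ⟨T, hT⟩ := hL.bddAbove
  refine ⟨T + 1, fun s hs => hLK fun hsL => ?_⟩
  exact absurd (hs.trans (hT hsL)) (not_le.2 (lt_add_one T))

theorem sameEnd_equivalence : Equivalence (SameEnd (X := X)) where
  refl r K hK := by
    obtain ⟨T, hT⟩ := r.exists_forall_ge_notMem hK
    refine ⟨T, fun s hs s' hs' => ?_⟩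
    have hpath : IsPathConnected (Ici T : Set ℝ≥0) := by
      refine ⟨T, self_mem_Ici, fun {u} hu => ?_⟩
      refine ⟨⟨⟨fun t => T + Real.toNNReal t * (u - T), by fun_prop⟩, by simp, ?_⟩, ?_⟩
      · simp [add_tsub_cancel_of_le (show T ≤ u from hu)]
      · intro t
        exact le_self_add (a := T)
    refine ((hpath.joinedIn s hs s' hs').map (map_continuous r)).mono ?_
    rintro _ ⟨u, hu, rfl⟩
    exact hT u hu
  symm h K hK := by
    obtain ⟨T, hT⟩ := h K hK
    exact ⟨T, fun s hs s' hs' => (hT s' hs' s hs).symm⟩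
  trans h h' K hK := by
    obtain ⟨T, hT⟩ := h K hK
    obtain ⟨T', hT'⟩ := h' K hK
    exact ⟨max T T', fun s hs s' hs' =>
      (hT s (le_of_max_le_left hs) s (le_of_max_le_left hs)).trans
        (hT' s (le_of_max_le_right hs) s' (le_of_max_le_right hs'))⟩

end ProperRay

/-- The equivalence relation on proper rays whose classes are the ends. -/
def endSetoid (X : Type*) [TopologicalSpace X] : Setoid (ProperRay X) :=
  ⟨ProperRay.SameEnd, ProperRay.sameEnd_equivalence⟩

/-- The set of ends of `X`. -/
def Ends (X : Type*) [TopologicalSpace X] : Type _ := Quotient (endSetoid X)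

namespace ProperRay

variable {X : Type*} [TopologicalSpace X]

/-- The end defined by a proper ray. -/
def toEnd (r : ProperRay X) : Ends X := Quotient.mk (endSetoid X) r

/-- The piece of a ray over `[n, n + 1]` as a singular `1`-simplex. -/
def segment (r : ProperRay X) (n : ℕ) : SingularSimplex 1 X where
  toFun t := r (n + Real.toNNReal (t 1))
  continuous_toFun := by
    refine (map_continuous r).comp (continuous_const.add (continuous_real_toNNReal.comp ?_))
    exact (continuous_apply (1 : Fin 2)).comp continuous_subtype_val

theorem finite_segment_meets (r : ProperRay X) {K : Set X} (hK : IsCompact K) :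
    {n : ℕ | (range (r.segment n) ∩ K).Nonempty}.Finite := by
  obtain ⟨T, hT⟩ := r.exists_forall_ge_notMem hK
  obtain ⟨N, hN⟩ := exists_nat_ge T
  refine (Set.finite_lt_nat N).subset ?_
  rintro n ⟨_, ⟨t, rfl⟩, ht⟩
  by_contra hn
  have hn' : (N : ℝ≥0) ≤ n := by exact_mod_cast not_lt.1 hn
  exact hT _ ((hN.trans hn').trans le_self_add) ht

/-- A ray as the locally finite `1`-chain `∑ n, r|[n, n + 1]`. -/
def chain (r : ProperRay X) : LFChain 1 X :=
  ⟨push r.segment 1, by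
    intro K hK
    refine ((r.finite_segment_meets hK).image r.segment).subset ?_
    rintro σ ⟨h0, hσ⟩
    obtain ⟨n, hn, -⟩ := exists_ne_zero_of_finsum_mem_ne_zero h0
    subst hn
    exact ⟨n, hσ, rfl⟩⟩

theorem fiberFinite_of_meets {n : ℕ} {g : ℕ → SingularSimplex n X}
    (h : ∀ K, IsCompact K → {m : ℕ | (range (g m) ∩ K).Nonempty}.Finite) : FiberFinite g 1 := by
  intro τ
  refine (h _ (isCompact_range τ.continuous)).subset ?_
  rintro m ⟨hm, -⟩
  change g m = τ at hm
  change (range (g m) ∩ range τ).Nonempty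
  rw [hm, inter_self]
  exact range_nonempty _

/-- The starting point of the `n`-th piece of a ray, as a singular `0`-simplex. -/
def point (r : ProperRay X) (n : ℕ) : SingularSimplex 0 X := ContinuousMap.const _ (r n)

theorem face_zero_segment (r : ProperRay X) (n : ℕ) :
    face 0 (r.segment n) = r.point (n + 1) := by
  ext t
  obtain rfl : t = stdSimplex.vertex 0 := Subsingleton.elim _ _
  change r (n + Real.toNNReal ((stdSimplex.map _ (stdSimplex.vertex 0)) 1)) = r _
  rw [stdSimplex.map_vertex]
  simp

theorem face_one_segment (r : ProperRay X) (n : ℕ) :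
    face 1 (r.segment n) = r.point n := by
  ext t
  obtain rfl : t = stdSimplex.vertex 0 := Subsingleton.elim _ _
  change r (n + Real.toNNReal ((stdSimplex.map _ (stdSimplex.vertex 0)) 1)) = r _
  rw [stdSimplex.map_vertex]
  simp

theorem push_one_succ {T : Type*} [DecidableEq T] (g : ℕ → T) (hg : FiberFinite g 1) :
    push g 1 = push (fun n => g (n + 1)) 1 + Pi.single (g 0) 1 := by
  funext τ
  have hfin : {n : ℕ | g n = τ}.Finite := by
    refine (hg τ).subset fun n hn => ⟨hn, ?_⟩
    simp
  have hfin' : {n : ℕ | g (n + 1) = τ}.Finite :=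
    hfin.preimage (f := Nat.succ) (Nat.succ_injective.injOn)
  have hsplit : {n : ℕ | g n = τ} = Nat.succ '' {n : ℕ | g (n + 1) = τ} ∪ {n | n = 0 ∧ g 0 = τ} := by
    ext n
    cases n <;> simp
  have hdisj : Disjoint (Nat.succ '' {n : ℕ | g (n + 1) = τ}) {n | n = 0 ∧ g 0 = τ} := by
    rw [Set.disjoint_left]
    rintro _ ⟨n, -, rfl⟩ ⟨h, -⟩
    exact Nat.succ_ne_zero n h
  have hfin0 : {n | n = 0 ∧ g 0 = τ}.Finite := (Set.finite_singleton 0).subset fun n hn => hn.1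
  change ∑ᶠ n ∈ {n : ℕ | g n = τ}, (1 : ℤ) = ∑ᶠ n ∈ {n : ℕ | g (n + 1) = τ}, (1 : ℤ) + _
  rw [hsplit, finsum_mem_union hdisj (hfin'.image _) hfin0,
    finsum_mem_image Nat.succ_injective.injOn]
  congr 1
  by_cases h : g 0 = τ
  · simp [h]
  · simp [h, Ne.symm h]

theorem boundary_chain [DecidableEq (SingularSimplex 0 X)] (r : ProperRay X) :
    (boundary 0 X r.chain).1 = - Pi.single (r.point 0) 1 := by
  have hseg := fiberFinite_of_meets fun K hK => r.finite_segment_meets hK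
  have hpt : FiberFinite r.point 1 := by
    refine fiberFinite_of_meets fun K hK => (r.finite_segment_meets hK).subset ?_
    rintro n ⟨_, ⟨t, rfl⟩, ht⟩
    have h := face_one_segment r n
    rw [← h] at ht
    exact ⟨_, ⟨_, rfl⟩, ht⟩
  have hpt' : FiberFinite (fun n => r.point (n + 1)) 1 := fun τ => by
    refine ((hpt τ).preimage (f := Nat.succ) Nat.succ_injective.injOn).subset ?_
    rintro n ⟨hn, -⟩
    exact ⟨hn, by simp⟩
  have h0 : face 0 ∘ r.segment = fun n => r.point (n + 1) := funext (face_zero_segment r)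
  have h1 : face 1 ∘ r.segment = r.point := funext (face_one_segment r)
  have e0 : push (face 0) (push r.segment 1) = push (fun n => r.point (n + 1)) 1 := by
    rw [push_comp _ _ _ (h0 ▸ hpt'), h0]
  have e1 : push (face 1) (push r.segment 1) = push r.point 1 := by
    rw [push_comp _ _ _ (h1 ▸ hpt), h1]
  have hb : (boundary 0 X r.chain).1 =
      push (face 0) (push r.segment 1) - push (face 1) (push r.segment 1) := by
    simp [boundary, Fin.sum_univ_two, pushHom, chain, sub_eq_add_neg]
  rw [hb, e0, e1, push_one_succ r.point hpt]
  abel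

theorem chain_sub_chain_mem_cycles (r r' : ProperRay X) (h : r 0 = r' 0) :
    r'.chain - r.chain ∈ cycles 1 X := by
  classical
  change boundary 0 X (r'.chain - r.chain) = 0
  refine Subtype.ext ?_
  have hp : r.point 0 = r'.point 0 := by
    simp [point, h]
  rw [map_sub, AddSubgroup.coe_sub, boundary_chain, boundary_chain, hp, sub_self]
  rfl

/-- The class in locally finite homology of the difference `r' - r` of two proper rays with the
same initial point. -/
def diffClass (r r' : ProperRay X) (h : r 0 = r' 0) : LFHomology 1 X :=
  QuotientAddGroup.mk ⟨r'.chain - r.chain, chain_sub_chain_mem_cycles r r' h⟩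

end ProperRay

end CoarseHomology

end

noncomputable section

namespace CoarseHomology

/-! ### Pairing infinite chains with cochains of compact support -/

/-! A locally finite 1-cycle is detected by cocycles of compact support. If `f : Z → ℤ` is locally
constant outside a compact set, its coboundary vanishes on every 1-simplex missing that set, because
a simplex is connected. It therefore pairs with locally finite chains, it kills boundaries since δδ
= 0, and it defines a functional on `LFHomology 1 Z` (`endFunctional`). On a difference of rays the
sum telescopes, so the value is the limit of `f` along the second ray minus its limit along the
first (`endFunctional_diffClass`).

To use this on coarse homology, suppose that a finite integral combination of the classes vanishes
in the direct limit. It then already vanishes on the nerve at some stage `m`. Finitely many rays to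
distinct ends are separated by a compact `K ⊂ X`, and hence by a function `f` that is constant on
path components of the complement of `K`. The covering sets at stage `m` have diameter at most `R
m`, and geodesics of length at most `R m` starting outside the `R m`-thickening of `K` miss `K`.
Hence `f` takes only one value on a covering set disjoint from this thickening, and it passes to a
function on the nerve that is locally constant outside a compact subcomplex (`Nerve.transfer`) and
agrees with `f` far out along the rays.

If `f` tends to 1 along `r j` for `i < j` and to 0 otherwise, the resulting functional takes the
value 1 on the `i`-th difference and 0 on every other one. So the `i`-th coefficient of the relation
is zero. The relation, and with it `m`, is fixed before `f` is chosen; no functional on the whole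
limit is needed. -/

/-- The pairing `∑ w σ * α σ` of a cochain with a formal sum. -/
def pairing {S : Type*} (w α : S → ℤ) : ℤ := ∑ᶠ σ, w σ * α σ

/-- Seen as a push-forward to a point, a total sum can be regrouped along fibres by `push_comp`. -/
theorem push_unit {S : Type*} (α : S → ℤ) : push (fun _ => ()) α () = ∑ᶠ σ, α σ := by
  simp [push]

theorem mul_push {S T : Type*} (Φ : S → T) (w : T → ℤ) (α : S → ℤ) :
    (fun τ => w τ * push Φ α τ) = push Φ fun σ => w (Φ σ) * α σ := by
  funext τ
  refine (mul_finsum_mem _ _).trans (finsum_mem_congr rfl fun σ hσ => ?_)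
  rw [show Φ σ = τ from hσ]

/-- The weight `w` is absorbed into the push-forward by `mul_push`; both sides are then
push-forwards to a point. Finiteness of the support is essential, since a `finsum` with infinite
support is 0 by default. -/
theorem pairing_push {S T : Type*} (Φ : S → T) (w : T → ℤ) (α : S → ℤ)
    (h : (Function.support fun σ => w (Φ σ) * α σ).Finite) :
    pairing w (push Φ α) = pairing (w ∘ Φ) α := by
  rw [pairing, mul_push, ← push_unit, push_comp _ _ _ fun _ => h.inter_of_right _]
  exact push_unit _

theorem pairing_add {S : Type*} {w α β : S → ℤ}
    (hα : (Function.support fun σ => w σ * α σ).Finite)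
    (hβ : (Function.support fun σ => w σ * β σ).Finite) :
    pairing w (α + β) = pairing w α + pairing w β := by
  rw [pairing, pairing, pairing, ← finsum_add_distrib hα hβ]
  simp only [Pi.add_apply, mul_add]

/-! ### Functionals on locally finite homology from functions locally constant at infinity -/

section LocallyConstant

variable {n : ℕ} {Z W : Type*} [TopologicalSpace Z] [TopologicalSpace W]

/-- A cochain supported on the simplices that meet a compact set. -/
def IsCompactlySupported (w : SingularSimplex n Z → ℤ) : Prop :=
  ∃ L : Set Z, IsCompact L ∧ ∀ σ, w σ ≠ 0 → (range σ ∩ L).Nonempty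

theorem IsCompactlySupported.finite_support {w : SingularSimplex n Z → ℤ}
    (hw : IsCompactlySupported w) (α : LFChain n Z) :
    (Function.support fun σ => w σ * α.1 σ).Finite := by
  obtain ⟨L, hL, h⟩ := hw
  exact (α.2 L hL).subset fun σ hσ =>
    ⟨right_ne_zero_of_mul (Function.mem_support.1 hσ),
      h σ (left_ne_zero_of_mul (Function.mem_support.1 hσ))⟩

/-- The pairing with a compactly supported cochain as a homomorphism on locally finite chains. -/
def pairingHom (w : SingularSimplex n Z → ℤ) (hw : IsCompactlySupported w) : LFChain n Z →+ ℤ where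
  toFun α := pairing w α.1
  map_zero' := by simp [pairing]
  map_add' α β := pairing_add (hw.finite_support α) (hw.finite_support β)

theorem IsCompactlySupported.comp {m : ℕ} {w : SingularSimplex m W → ℤ}
    (hw : IsCompactlySupported w) {Φ : SingularSimplex n Z → SingularSimplex m W}
    (hΦ : IsProperOnSimplices Φ) : IsCompactlySupported (w ∘ Φ) := by
  obtain ⟨L, hL, h⟩ := hw
  obtain ⟨M, hM, h'⟩ := hΦ L hL
  exact ⟨M, hM, fun σ hσ => h' σ (h _ hσ)⟩

theorem pairingHom_pushHom {m : ℕ} {w : SingularSimplex m W → ℤ} (hw : IsCompactlySupported w)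
    {Φ : SingularSimplex n Z → SingularSimplex m W} (hΦ : IsProperOnSimplices Φ)
    (α : LFChain n Z) :
    pairingHom w hw (pushHom Φ hΦ α) = pairingHom (w ∘ Φ) (hw.comp hΦ) α :=
  pairing_push Φ w α.1 ((hw.comp hΦ).finite_support α)

/-- The function `f` is locally constant outside a compact set. -/
def EventuallyLocallyConstant (f : Z → ℤ) : Prop :=
  ∃ L : Set Z, IsCompact L ∧ ∀ z ∉ L, ∀ᶠ z' in 𝓝 z, f z' = f z

/-- The coboundary of a function regarded as a `0`-cochain. -/
def coboundary (f : Z → ℤ) (σ : SingularSimplex 1 Z) : ℤ :=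
  f (σ (stdSimplex.vertex 1)) - f (σ (stdSimplex.vertex 0))

/-- On a simplex that misses the exceptional compact set `f` is locally constant, hence constant
because the standard simplex is connected, and its two endpoint values cancel. -/
theorem EventuallyLocallyConstant.isCompactlySupported {f : Z → ℤ}
    (hf : EventuallyLocallyConstant f) : IsCompactlySupported (coboundary f) := by
  obtain ⟨L, hL, h⟩ := hf
  refine ⟨L, hL, fun σ hσ => ?_⟩
  by_contra hne
  rw [not_nonempty_iff_eq_empty] at hne
  have hlc : IsLocallyConstant (f ∘ σ) := by
    rw [IsLocallyConstant.iff_eventually_eq]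
    intro t
    refine σ.continuous.continuousAt.eventually (h (σ t) fun ht => ?_)
    exact (hne ▸ ⟨⟨t, rfl⟩, ht⟩ : σ t ∈ (∅ : Set Z))
  exact hσ (sub_eq_zero.2 (hlc.apply_eq_of_preconnectedSpace _ _))

/-- Evaluation of the coboundary of a function that is locally constant outside a compact set. -/
def coboundaryHom (f : Z → ℤ) (hf : EventuallyLocallyConstant f) : LFChain 1 Z →+ ℤ :=
  pairingHom (coboundary f) hf.isCompactlySupported

theorem coboundary_face (f : Z → ℤ) (τ : SingularSimplex 2 Z) :
    coboundary f (face 0 τ) - coboundary f (face 1 τ) + coboundary f (face 2 τ) = 0 := by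
  simp only [coboundary, face, ContinuousMap.comp_apply, ContinuousMap.coe_mk,
    stdSimplex.map_vertex]
  have h0 : (0 : Fin 3).succAbove (0 : Fin 2) = 1 := rfl
  have h1 : (0 : Fin 3).succAbove (1 : Fin 2) = 2 := rfl
  have h2 : (1 : Fin 3).succAbove (0 : Fin 2) = 0 := rfl
  have h3 : (1 : Fin 3).succAbove (1 : Fin 2) = 2 := rfl
  have h4 : (2 : Fin 3).succAbove (0 : Fin 2) = 0 := rfl
  have h5 : (2 : Fin 3).succAbove (1 : Fin 2) = 1 := rfl
  rw [h0, h1, h2, h3, h4, h5]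
  ring

/-- By adjointness each face map moves onto the cochain. Finite supports allow the three sums to be
merged into one, whose terms vanish by `coboundary_face`. -/
theorem coboundaryHom_boundary (f : Z → ℤ) (hf : EventuallyLocallyConstant f)
    (β : LFChain 2 Z) : coboundaryHom f hf (boundary 1 Z β) = 0 := by
  have hc := fun i : Fin 3 => (hf.isCompactlySupported.comp
    (isProperOnSimplices_face (n := 1) (Z := Z) i)).finite_support β
  have hb : boundary 1 Z = _ := Fin.sum_univ_three _
  simp only [hb, AddMonoidHom.add_apply, AddMonoidHom.smul_apply,
    map_add, map_zsmul, coboundaryHom, pairingHom_pushHom]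
  change (-1 : ℤ) ^ 0 • (∑ᶠ τ, _) + (-1 : ℤ) ^ 1 • (∑ᶠ τ, _) + (-1 : ℤ) ^ 2 • (∑ᶠ τ, _) = 0
  rw [pow_zero, pow_one, one_smul, neg_smul, one_smul, ← sub_eq_add_neg, neg_one_sq, one_smul,
    ← finsum_sub_distrib (hc 0) (hc 1), ← finsum_add_distrib _ (hc 2)]
  · refine finsum_eq_zero_of_forall_eq_zero fun τ => ?_
    rw [← sub_mul, ← add_mul]
    exact mul_eq_zero_of_left (coboundary_face f τ) _
  · exact ((hc 0).union (hc 1)).subset (Function.support_sub _ _)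

/-- The functional on first locally finite homology defined by a function that is locally constant
outside a compact set. -/
def endFunctional (f : Z → ℤ) (hf : EventuallyLocallyConstant f) : LFHomology 1 Z →+ ℤ :=
  QuotientAddGroup.lift _ ((coboundaryHom f hf).comp (cycles 1 Z).subtype) (by
    rintro ⟨α, hα⟩ ⟨β, hβ⟩
    change coboundaryHom f hf α = 0
    rw [← show boundary 1 Z β = α from hβ, coboundaryHom_boundary])

theorem EventuallyLocallyConstant.comp {f : W → ℤ} (hf : EventuallyLocallyConstant f)
    (φ : CocompactMap Z W) : EventuallyLocallyConstant (f ∘ φ) := by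
  obtain ⟨L, hL, h⟩ := hf
  obtain ⟨M, hM, hML⟩ := mem_cocompact.1
    (CocompactMapClass.cocompact_tendsto φ hL.compl_mem_cocompact)
  exact ⟨M, hM, fun z hz => (map_continuous φ).continuousAt.eventually (h (φ z) (hML hz))⟩

theorem endFunctional_map (f : W → ℤ) (hf : EventuallyLocallyConstant f) (φ : CocompactMap Z W)
    (x : LFHomology 1 Z) :
    endFunctional f hf (LFHomology.map 1 φ x) = endFunctional (f ∘ φ) (hf.comp φ) x := by
  obtain ⟨α, rfl⟩ := QuotientAddGroup.mk_surjective x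
  exact pairingHom_pushHom hf.isCompactlySupported (isProperOnSimplices_postcomp 1 φ) α.1

/-- The values on the unit segments telescope, and the segments in the constant tail contribute
nothing. -/
theorem coboundaryHom_chain (f : Z → ℤ) (hf : EventuallyLocallyConstant f) (r : ProperRay Z)
    {c : ℤ} {T : ℝ≥0} (hc : ∀ s ≥ T, f (r s) = c) : coboundaryHom f hf r.chain = c - f (r 0) := by
  obtain ⟨N, hN⟩ := exists_nat_ge T
  have hseg : ∀ n, coboundary f (r.segment n) = f (r (n + 1 : ℕ)) - f (r n) := fun n => by
    simp [coboundary, ProperRay.segment]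
  -- Since `N ≥ T`, both endpoints of every segment from index `N` on lie in the tail where `f`
  -- equals `c`.
  have hzero : ∀ n, coboundary f (r.segment n) ≠ 0 → n ∈ Finset.range N := by
    intro n hn
    rw [Finset.mem_range]
    by_contra hlt
    have hle : (N : ℝ≥0) ≤ n := by exact_mod_cast not_lt.1 hlt
    have hle' : (N : ℝ≥0) ≤ (n + 1 : ℕ) := hle.trans (by exact_mod_cast n.le_succ)
    exact hn (by rw [hseg, hc _ (hN.trans hle'), hc _ (hN.trans hle), sub_self])
  have hsupp : (Function.support fun n => coboundary f (r.segment n) * (1 : ℕ → ℤ) n) ⊆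
      Finset.range N := fun n hn => hzero n (left_ne_zero_of_mul (Function.mem_support.1 hn))
  change pairing _ (push r.segment 1) = _
  rw [pairing_push _ _ _ ((Finset.finite_toSet _).subset hsupp), pairing]
  refine (finsum_eq_sum_of_support_subset _ hsupp).trans ?_
  simp only [Pi.one_apply, mul_one, hseg]
  rw [Finset.sum_range_sub fun n => f (r n), hc N hN, Nat.cast_zero]

theorem endFunctional_diffClass (f : Z → ℤ) (hf : EventuallyLocallyConstant f)
    (r r' : ProperRay Z) (h : r 0 = r' 0) {c c' : ℤ} (hc : ∀ᶠ s in atTop, f (r s) = c)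
    (hc' : ∀ᶠ s in atTop, f (r' s) = c') :
    endFunctional f hf (r.diffClass r' h) = c' - c := by
  obtain ⟨T, hT⟩ := eventually_atTop.1 hc
  obtain ⟨T', hT'⟩ := eventually_atTop.1 hc'
  change coboundaryHom f hf (r'.chain - r.chain) = _
  rw [map_sub, coboundaryHom_chain f hf r hT, coboundaryHom_chain f hf r' hT', h]
  ring

end LocallyConstant

/-! ### The directed system of a coarsening sequence -/

section Functoriality

variable {Z W V : Type*} [TopologicalSpace Z] [TopologicalSpace W] [TopologicalSpace V]

theorem LFHomology.map_id (n : ℕ) (x : LFHomology n Z) :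
    LFHomology.map n (CocompactMap.id Z) x = x := by
  obtain ⟨α, rfl⟩ := QuotientAddGroup.mk_surjective x
  have h : cyclesMap n (CocompactMap.id Z) α = α := by
    refine Subtype.ext (Subtype.ext (funext fun τ => ?_))
    change ∑ᶠ σ ∈ {σ | σ = τ}, α.1.1 σ = _
    exact finsum_mem_singleton
  exact congrArg QuotientAddGroup.mk h

theorem LFHomology.map_comp (n : ℕ) (g : CocompactMap W V) (f : CocompactMap Z W)
    (x : LFHomology n Z) :
    LFHomology.map n (g.comp f) x = LFHomology.map n g (LFHomology.map n f x) := by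
  obtain ⟨α, rfl⟩ := QuotientAddGroup.mk_surjective x
  have h : cyclesMap n (g.comp f) α = cyclesMap n g (cyclesMap n f α) :=
    Subtype.ext (pushHom_pushHom (isProperOnSimplices_postcomp n g)
      (isProperOnSimplices_postcomp n f) α.1).symm
  exact congrArg QuotientAddGroup.mk h

end Functoriality

theorem Nerve.ext_coord {X ι : Type*} [MetricSpace X] {𝒰 : BoundedCover X ι} {t t' : Nerve 𝒰}
    (h : t.coord = t'.coord) : t = t' := by
  cases t
  cases t'
  cases h
  rfl

namespace CoarseningSequence

variable {X : Type*} [MetricSpace X] (C : CoarseningSequence X)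

theorem assign_self (n : ℕ) : C.assign (le_refl n) = id :=
  funext fun i => Nat.leRecOn_self i

theorem assign_assign {n m l : ℕ} (h : n ≤ m) (h' : m ≤ l) :
    C.assign h' ∘ C.assign h = C.assign (h.trans h') :=
  funext fun i => (Nat.leRecOn_trans h h' i).symm

variable [ProperSpace X]

theorem coarsen_self (n : ℕ) : C.coarsen (le_refl n) = CocompactMap.id _ :=
  CocompactMap.ext fun t => Nerve.ext_coord <| by
    change t.coord.mapDomain (C.assign (le_refl n)) = t.coord
    rw [assign_self, Finsupp.mapDomain_id]

theorem coarsen_comp {n m l : ℕ} (h : n ≤ m) (h' : m ≤ l) :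
    (C.coarsen h').comp (C.coarsen h) = C.coarsen (h.trans h') :=
  CocompactMap.ext fun t => Nerve.ext_coord <| by
    change (t.coord.mapDomain (C.assign h)).mapDomain (C.assign h') =
      t.coord.mapDomain (C.assign (h.trans h'))
    rw [← Finsupp.mapDomain_comp, assign_assign]

instance directedSystem (q : ℕ) :
    DirectedSystem (fun n => LFHomology q (Nerve (C.cover n)))
      fun _ _ h => LFHomology.map q (C.coarsen h) where
  map_self n x := by rw [coarsen_self, LFHomology.map_id]
  map_map n m l h h' x := by rw [← LFHomology.map_comp, coarsen_comp]

/-- This replaces a relation in coarse homology by a relation on one nerve, where the diameters have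
a single bound. It relies on the functoriality recorded in `directedSystem`. -/
theorem exists_map_eq_zero_of_toHX_eq_zero {q n : ℕ} {x : LFHomology q (Nerve (C.cover n))}
    (hx : C.toHX q n x = 0) :
    ∃ (m : ℕ) (h : n ≤ m), LFHomology.map q (C.coarsen h) x = 0 :=
  AddCommGroup.DirectLimit.of.zero_exact _ _ hx

end CoarseningSequence

/-! ### Rays and path components at infinity -/

section Rays

variable {X : Type*} [MetricSpace X]

theorem IsGeodesic.joinedIn (hX : IsGeodesic X) (x y : X) :
    JoinedIn (Metric.closedBall x (dist x y)) x y := by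
  obtain ⟨γ, h0, h1, hγ⟩ := hX x y
  have hmem0 : (0 : ℝ) ∈ Icc 0 (dist x y) := ⟨le_rfl, dist_nonneg⟩
  have hmem1 : dist x y ∈ Icc 0 (dist x y) := ⟨dist_nonneg, le_rfl⟩
  have hcont : ContinuousOn γ (Icc 0 (dist x y)) := by
    refine LipschitzOnWith.continuousOn (K := 1) (LipschitzOnWith.of_dist_le_mul fun s hs t ht => ?_)
    rw [hγ s hs t ht, NNReal.coe_one, one_mul, Real.dist_eq]
  have hpc : IsPathConnected (γ '' Icc 0 (dist x y)) :=
    ((convex_Icc _ _).isPathConnected ⟨0, hmem0⟩).image' hcont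
  refine (hpc.joinedIn x ⟨0, hmem0, h0⟩ y ⟨_, hmem1, h1⟩).mono ?_
  rintro _ ⟨t, ht, rfl⟩
  rw [Metric.mem_closedBall, ← h0, hγ t ht 0 hmem0, sub_zero, abs_of_nonneg ht.1]
  rw [h0]
  exact ht.2

/-- A geodesic from `x` to `y` stays within distance `R` of `x`, so it cannot reach `K`. -/
theorem IsGeodesic.joinedIn_compl (hX : IsGeodesic X) {K : Set X} {R : ℝ} {x y : X}
    (hx : x ∉ Metric.cthickening R K) (hxy : dist x y ≤ R) : JoinedIn Kᶜ x y := by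
  refine (hX.joinedIn x y).mono fun z hz hzK => hx ?_
  refine Metric.mem_cthickening_of_dist_le x z R K hzK ?_
  rw [dist_comm]
  exact (Metric.mem_closedBall.1 hz).trans hxy

theorem IsGeodesic.joined (hX : IsGeodesic X) (x y : X) : Joined x y :=
  (hX.joinedIn x y).joined

/-! ### Changing initial points and separating distinct ends -/

namespace ProperRay

variable {Z : Type*} [TopologicalSpace Z]

/-- The ray that first runs through a path to the initial point of a given ray. -/
def prepend (r : ProperRay Z) {z : Z} (p : Path z (r 0)) : ProperRay Z where
  toFun s := if s ≤ 1 then p.extend (s : ℝ) else r (s - 1)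
  continuous_toFun := by
    refine Continuous.if_le (p.continuous_extend.comp NNReal.continuous_coe)
      ((map_continuous r).comp (continuous_id.sub continuous_const)) continuous_id
      continuous_const ?_
    intro s hs
    simp [show s = 1 from hs]
  cocompact_tendsto' := by
    intro S hS
    obtain ⟨K, hK, hKS⟩ := mem_cocompact.1 hS
    obtain ⟨T, hT⟩ := r.exists_forall_ge_notMem hK
    -- The prepended path delays the ray by one unit, so times beyond `T + 1` correspond to times at
    -- least `T` on `r`.
    refine mem_cocompact.2 ⟨Icc 0 (T + 1), isCompact_Icc, fun s hs => hKS ?_⟩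
    have hs' : T + 1 < s := by
      by_contra h
      exact hs ⟨zero_le, not_lt.1 h⟩
    have h1 : ¬ s ≤ 1 := not_le.2 (lt_of_le_of_lt (le_add_self (a := 1) (b := T)) hs')
    simp only [h1, if_false]
    exact hT _ (le_tsub_of_add_le_right hs'.le)

theorem prepend_zero (r : ProperRay Z) {z : Z} (p : Path z (r 0)) : r.prepend p 0 = z := by
  change (if (0 : ℝ≥0) ≤ 1 then p.extend ((0 : ℝ≥0) : ℝ) else _) = z
  simp

theorem prepend_of_one_lt (r : ProperRay Z) {z : Z} (p : Path z (r 0)) {s : ℝ≥0} (hs : 1 < s) :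
    r.prepend p s = r (s - 1) :=
  if_neg (not_le.2 hs)

theorem toEnd_prepend (r : ProperRay Z) {z : Z} (p : Path z (r 0)) :
    (r.prepend p).toEnd = r.toEnd := by
  refine Quotient.sound fun K hK => ?_
  obtain ⟨T, hT⟩ := sameEnd_equivalence.refl r K hK
  -- One unit accounts for the delay; the second makes `s > 1` strict even when `T = 0`.
  refine ⟨T + 2, fun s hs s' hs' => ?_⟩
  have h1 : 1 < s := lt_of_lt_of_le one_lt_two ((le_add_self (a := 2) (b := T)).trans hs)
  rw [prepend_of_one_lt r p h1]
  refine hT _ (le_tsub_of_add_le_right (le_trans ?_ hs)) _ (le_self_add.trans hs')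
  gcongr
  exact one_le_two

/-- Finitely many rays to distinct ends are separated by a compact set. -/
theorem exists_isCompact_not_joinedIn {J : Type*} (r : J → ProperRay Z)
    (hr : Function.Injective fun j => (r j).toEnd) (S : Finset J) :
    ∃ K : Set Z, IsCompact K ∧ ∃ T : ℝ≥0, ∀ i ∈ S, ∀ j ∈ S, ∀ s ≥ T, ∀ s' ≥ T,
      JoinedIn Kᶜ (r i s) (r j s') ↔ i = j := by
  classical
  -- Diagonal pairs receive the empty set, so that one choice function serves all pairs.
  have hex : ∀ p : J × J, ∃ K : Set Z, IsCompact K ∧ (p.1 ≠ p.2 →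
      ∀ T : ℝ≥0, ∃ s ≥ T, ∃ s' ≥ T, ¬ JoinedIn Kᶜ (r p.1 s) (r p.2 s')) := by
    intro p
    by_cases hp : p.1 = p.2
    · exact ⟨∅, isCompact_empty, fun h => absurd hp h⟩
    · have h : ¬ SameEnd (r p.1) (r p.2) := fun h => hp (hr (Quotient.sound h))
      rw [SameEnd] at h
      push Not at h
      obtain ⟨K, hK, h⟩ := h
      exact ⟨K, hK, fun _ => h⟩
  choose K hK hsep using hex
  have hL : IsCompact (⋃ p ∈ S ×ˢ S, K p) := (S ×ˢ S).isCompact_biUnion fun p _ => hK p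
  -- Reflexivity of `SameEnd` says that the tail of each ray lies in a single path component of the
  -- complement of the union.
  choose T hT using fun i => sameEnd_equivalence.refl (r i) _ hL
  have hTle : ∀ i ∈ S, T i ≤ S.sup T := fun i hi => Finset.le_sup hi
  refine ⟨_, hL, S.sup T, fun i hi j hj s hs s' hs' => ⟨fun h => ?_, ?_⟩⟩
  · by_contra hij
    -- A path between the two tails outside the union extends along the tails to the times `t` and
    -- `t'`, which cannot be joined even outside the smaller set `K (i, j)`.
    obtain ⟨t, ht, t', ht', hn⟩ := hsep (i, j) hij (S.sup T)
    refine hn (JoinedIn.mono (((hT i t ((hTle i hi).trans ht) s ((hTle i hi).trans hs)).trans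
      h).trans (hT j s' ((hTle j hj).trans hs') t' ((hTle j hj).trans ht'))) ?_)
    exact compl_subset_compl.2 (subset_biUnion_of_mem (u := K)
      (show (i, j) ∈ (↑(S ×ˢ S) : Set (J × J)) from Finset.mem_product.2 ⟨hi, hj⟩))
  · rintro rfl
    exact hT i s ((hTle i hi).trans hs) s' ((hTle i hi).trans hs')

/-- Finitely many rays to distinct ends are separated by a function that is constant on the path
components of the complement of a compact set. -/
theorem exists_separating_function {J : Type*} (r : J → ProperRay Z)
    (hr : Function.Injective fun j => (r j).toEnd) (S : Finset J) (P : J → Prop)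
    [DecidablePred P] :
    ∃ (f : Z → ℤ) (K : Set Z), IsCompact K ∧ (∀ x y, JoinedIn Kᶜ x y → f x = f y) ∧
      ∀ i ∈ S, ∀ᶠ s in atTop, f (r i s) = if P i then 1 else 0 := by
  classical
  obtain ⟨K, hK, T, hT⟩ := exists_isCompact_not_joinedIn r hr S
  -- The function is the indicator of those path components of the complement of `K` that contain
  -- the tail of a selected ray.
  refine ⟨fun x => if ∃ i ∈ S, P i ∧ JoinedIn Kᶜ (r i T) x then 1 else 0, K, hK, ?_, ?_⟩
  · intro x y hxy
    refine if_congr (exists_congr fun i => and_congr_right fun _ => and_congr_right fun _ => ?_)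
      rfl rfl
    exact ⟨fun h => h.trans hxy, fun h => h.trans hxy.symm⟩
  · intro j hj
    filter_upwards [eventually_ge_atTop T] with s hs
    refine if_congr ⟨?_, fun h => ⟨j, hj, h, (hT j hj j hj T le_rfl s hs).2 rfl⟩⟩ rfl rfl
    rintro ⟨i, hi, hP, h⟩
    exact (hT i hi j hj T le_rfl s hs).1 h ▸ hP

theorem tendsto_cocompact (r : ProperRay Z) : Tendsto r atTop (cocompact Z) := by
  intro S hS
  obtain ⟨K, hK, hKS⟩ := mem_cocompact.1 hS
  obtain ⟨T, hT⟩ := r.exists_forall_ge_notMem hK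
  exact mem_map.2 ((eventually_ge_atTop T).mono fun s hs => hKS (hT s hs))

/-- There are rays with a common initial point to any family of ends. -/
theorem exists_rays_of_ends (hX : IsGeodesic X) [Nonempty X] {J : Type*} (e : J → Ends X) :
    ∃ r : J → ProperRay X, (∀ i j, r i 0 = r j 0) ∧ ∀ j, (r j).toEnd = e j := by
  obtain ⟨x⟩ := ‹Nonempty X›
  choose r hr using fun j => Quotient.exists_rep (e j)
  refine ⟨fun j => (r j).prepend (hX.joined x (r j 0)).somePath, fun i j => ?_, fun j => ?_⟩
  · rw [prepend_zero, prepend_zero]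
  · rw [toEnd_prepend]
    exact hr j

end ProperRay

end Rays

/-! ### Transfer to nerves -/

section Transfer

variable {X ι : Type*} [MetricSpace X]

/-- A function on `X` evaluated at a common point of the covering sets that span the carrier of a
point of the nerve. -/
def Nerve.transfer (𝒰 : BoundedCover X ι) (f : X → ℤ) (t : Nerve 𝒰) : ℤ :=
  f t.nonempty_inter.choose

variable {𝒰 : BoundedCover X ι} {f : X → ℤ} {K : Set X} {R : ℝ}

/-- The chosen common point lies in `U i` together with `x`, hence within `R` of it. Far from `K`
the choice therefore does not matter: a single vertex of the carrier determines the value. -/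
theorem Nerve.transfer_eq (hX : IsGeodesic X) (hR : ∀ i, Metric.diam (𝒰.U i) ≤ R)
    (hf : ∀ x y, JoinedIn Kᶜ x y → f x = f y) {t : Nerve 𝒰} {i : ι} (hi : i ∈ t.coord.support)
    {x : X} (hxi : x ∈ 𝒰.U i) (hx : x ∉ Metric.cthickening R K) :
    Nerve.transfer 𝒰 f t = f x := by
  have h := mem_iInter₂.1 t.nonempty_inter.choose_spec i hi
  exact (hf _ _ (hX.joinedIn_compl hx
    ((Metric.dist_le_diam_of_mem (𝒰.isBounded i) hxi h).trans (hR i)))).symm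

/-- The exceptional compact set consists of the points supported on the finitely many indices whose
sets meet the `R`-thickening of `K`. A point outside it has a vertex `i` with `U i` away from the
thickening, and nearby points keep that vertex. -/
theorem Nerve.eventuallyLocallyConstant_transfer [ProperSpace X] (hX : IsGeodesic X)
    (hR : ∀ i, Metric.diam (𝒰.U i) ≤ R) (hK : IsCompact K)
    (hf : ∀ x y, JoinedIn Kᶜ x y → f x = f y) :
    EventuallyLocallyConstant (Nerve.transfer 𝒰 f) := by
  have hB := Nerve.finite_inter 𝒰 (hK.isBounded.cthickening (δ := R))
  refine ⟨_, Nerve.isCompact_support_subset 𝒰 hB.toFinset, fun t ht => ?_⟩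
  obtain ⟨i, hi, hiB⟩ := Finset.not_subset.1 ht
  have hfar : ∀ x ∈ 𝒰.U i, x ∉ Metric.cthickening R K := fun x hx hxK =>
    hiB (hB.mem_toFinset.2 ⟨x, hx, hxK⟩)
  have hx := mem_iInter₂.1 t.nonempty_inter.choose_spec i hi
  filter_upwards [(Nerve.continuous_coord i).continuousAt.eventually_ne
    (Finsupp.mem_support_iff.1 hi)] with t' ht'
  -- Here `x` is the point chosen for `t`, so `f x` is by definition the transferred value at `t`.
  exact Nerve.transfer_eq hX hR hf (Finsupp.mem_support_iff.2 ht') hx (hfar _ hx)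

end Transfer

/-! ### Linear independence -/

namespace CoarseningSequence

variable {X : Type*} [MetricSpace X] [ProperSpace X] (C : CoarseningSequence X)

/-- This lets `Nerve.transfer_eq` be applied at `x` itself, so that far from `K` the transferred
function pulls back to the original one on `X`. -/
theorem exists_mem_support_coarsen_ofPartition {n m : ℕ} (h : n ≤ m)
    (ρ : PartitionOfUnity (C.ι n) X) (hρ : ρ.IsSubordinate (C.cover n).U) (x : X) :
    ∃ i ∈ (C.coarsen h (Nerve.ofPartition ρ hρ x)).coord.support, x ∈ (C.cover m).U i := by
  classical
  obtain ⟨i, hi⟩ := (C.coarsen h (Nerve.ofPartition ρ hρ x)).exists_mem_support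
  refine ⟨i, hi, ?_⟩
  obtain ⟨j, hj, rfl⟩ := Finset.mem_image.1 (Finsupp.mapDomain_support hi)
  exact C.subset_assign h j (hρ j (subset_tsupport _ (Finsupp.mem_support_iff.1 hj)))

/-- Rays to distinct ends are separated by functions on the nerves that are locally constant
outside a compact set. -/
theorem exists_separating_function (hX : IsGeodesic X) {J : Type*} (r : J → ProperRay X)
    (hr : Function.Injective fun j => (r j).toEnd) (S : Finset J) (P : J → Prop)
    [DecidablePred P] {n m : ℕ} (h : n ≤ m)
    (ρ : PartitionOfUnity (C.ι n) X) (hρ : ρ.IsSubordinate (C.cover n).U) :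
    ∃ F : Nerve (C.cover m) → ℤ, EventuallyLocallyConstant F ∧ ∀ i ∈ S, ∀ᶠ s in atTop,
      F (C.coarsen h (Nerve.ofPartition ρ hρ (r i s))) = if P i then 1 else 0 := by
  obtain ⟨f, K, hK, hf, hfr⟩ := ProperRay.exists_separating_function r hr S P
  refine ⟨Nerve.transfer _ f,
    Nerve.eventuallyLocallyConstant_transfer hX (C.diam_le m) hK hf, fun i hi => ?_⟩
  -- A proper ray eventually leaves the thickening of `K` whose width is the diameter bound of stage
  -- `m`.
  have hfar := (r i).tendsto_cocompact
    (hK.cthickening (r := C.R m)).compl_mem_cocompact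
  filter_upwards [hfr i hi, hfar] with s hs hs'
  obtain ⟨j, hj, hsj⟩ := C.exists_mem_support_coarsen_ofPartition h ρ hρ (r i s)
  rw [Nerve.transfer_eq hX (C.diam_le m) hf hj hsj hs', hs]

/-- For each index `i` of a relation, a functional at the stage where the relation dies extracts the
`i`-th coefficient. -/
theorem linearIndependent_fromLF_diffClass (hX : IsGeodesic X) {k : ℕ∞}
    (r : {j : ℕ // (j : ℕ∞) < k} → ProperRay X) (hr : ∀ i j, r i 0 = r j 0)
    (hinj : Function.Injective fun j => (r j).toEnd) (n : ℕ)
    (ρ : PartitionOfUnity (C.ι n) X) (hρ : ρ.IsSubordinate (C.cover n).U) :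
    LinearIndependent ℤ fun j : {j : ℕ // (j : ℕ∞) + 1 < k} =>
      C.fromLF 1 n ρ hρ (ProperRay.diffClass
        (r ⟨j, lt_of_le_of_lt le_self_add j.2⟩) (r ⟨j + 1, by exact_mod_cast j.2⟩) (hr _ _)) := by
  classical
  rw [linearIndependent_iff']
  intro s g hg i hi
  let a : {j : ℕ // (j : ℕ∞) + 1 < k} → {j : ℕ // (j : ℕ∞) < k} :=
    fun j => ⟨j, lt_of_le_of_lt le_self_add j.2⟩
  let b : {j : ℕ // (j : ℕ∞) + 1 < k} → {j : ℕ // (j : ℕ∞) < k} :=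
    fun j => ⟨j + 1, by exact_mod_cast j.2⟩
  let d : {j : ℕ // (j : ℕ∞) + 1 < k} → LFHomology 1 X :=
    fun j => ProperRay.diffClass (r (a j)) (r (b j)) (hr _ _)
  have hg' : C.toHX 1 n (LFHomology.map 1 (Nerve.ofPartition ρ hρ) (∑ j ∈ s, g j • d j)) = 0 := by
    refine Eq.trans ?_ hg
    change C.fromLF 1 n ρ hρ _ = _
    rw [map_sum]
    exact Finset.sum_congr rfl fun j _ => map_zsmul _ _ _
  obtain ⟨m, hnm, hm⟩ := C.exists_map_eq_zero_of_toHX_eq_zero hg'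
  -- Only the finitely many rays in the relation need to be separated. The predicate `i < j` makes
  -- the limit of `F` jump exactly between the rays `i` and `i + 1`.
  obtain ⟨F, hF, hFr⟩ := C.exists_separating_function hX r hinj (s.image a ∪ s.image b)
    (fun j => i.1 < j.1) hnm ρ hρ
  have hval : ∀ j ∈ s, endFunctional F hF (LFHomology.map 1 (C.coarsen hnm)
      (LFHomology.map 1 (Nerve.ofPartition ρ hρ) (d j))) = if j = i then 1 else 0 := by
    intro j hj
    rw [endFunctional_map, endFunctional_map, endFunctional_diffClass _ _ _ _ _
      (hFr (a j) (Finset.mem_union_left _ (Finset.mem_image_of_mem _ hj)))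
      (hFr (b j) (Finset.mem_union_right _ (Finset.mem_image_of_mem _ hj)))]
    change (if i.1 < j.1 + 1 then (1 : ℤ) else 0) - (if i.1 < j.1 then 1 else 0) = _
    simp only [Subtype.ext_iff]
    split_ifs <;> omega
  have h0 := congrArg (endFunctional F hF) hm
  simp only [map_sum, map_zsmul, map_zero] at h0
  rw [Finset.sum_congr rfl fun j hj => by rw [hval j hj]] at h0
  simpa [hi] using h0

end CoarseningSequence

/-! ### Indexing the ends and assembling the theorem -/

/-- For infinite `E` the index type contains every natural number, and any countable sequence of
distinct elements suffices; it need not exhaust `E`. -/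
theorem exists_injective_of_card_eq {E : Type*} {k : ℕ∞} (hk : ENat.card E = k) :
    ∃ e : {j : ℕ // (j : ℕ∞) < k} → E, Function.Injective e := by
  subst hk
  cases finite_or_infinite E with
  | inl h =>
    have hlt : ∀ j : {j : ℕ // (j : ℕ∞) < ENat.card E}, j.1 < Nat.card E := fun j => by
      exact_mod_cast lt_of_lt_of_eq j.2 (ENat.card_eq_coe_natCard E)
    exact ⟨fun j => (Finite.equivFin E).symm ⟨j, hlt j⟩, fun i j hij =>
      Subtype.ext (Fin.mk.inj ((Finite.equivFin E).symm.injective hij))⟩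
  | inr h =>
    exact ⟨fun j => Infinite.natEmbedding E j, fun i j hij =>
      Subtype.ext ((Infinite.natEmbedding E).injective hij)⟩

/-- A linearly independent family freely generates a subgroup. -/
theorem exists_addSubgroup_of_linearIndependent {A J : Type*} [AddCommGroup A] {v : J → A}
    (hv : LinearIndependent ℤ v) :
    ∃ B : AddSubgroup A, Nonempty (B ≃+ DirectSum J fun _ => ℤ) := by
  classical
  exact ⟨(Submodule.span ℤ (range v)).toAddSubgroup,
    ⟨(hv.linearCombinationEquiv.symm.trans (finsuppLEquivDirectSum ℤ ℤ J)).toAddEquiv⟩⟩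

end CoarseHomology

end

theorem mainTheorem6 {X : Type*} [MetricSpace X] [ProperSpace X] [ConnectedSpace X]
    (hX : CoarseHomology.IsGeodesic X) (k : ℕ∞) (hk : ENat.card (CoarseHomology.Ends X) = k)
    (C : CoarseHomology.CoarseningSequence X) :
    -- `HX₁(X; ℤ)` contains a subgroup isomorphic to the direct sum of `k - 1` copies of `ℤ`
    (∃ A : AddSubgroup (C.HX 1), Nonempty (A ≃+ DirectSum {j : ℕ // (j : ℕ∞) + 1 < k} fun _ => ℤ)) ∧
    -- there are rays `r₀, r₁, …` with a common initial point that define `k` distinct ends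
    (∃ r : {j : ℕ // (j : ℕ∞) < k} → CoarseHomology.ProperRay X,
      (∀ i j, r i 0 = r j 0) ∧ Function.Injective fun j => (r j).toEnd) ∧
    -- for all such rays, the classes of the differences `r (j + 1) - r j` generate freely, i.e.
    -- they are linearly independent over `ℤ` and so form a basis of a subgroup as above
    (∀ r : {j : ℕ // (j : ℕ∞) < k} → CoarseHomology.ProperRay X,
      ∀ hr : ∀ i j, r i 0 = r j 0, (Function.Injective fun j => (r j).toEnd) →
      ∀ (n : ℕ) (ρ : PartitionOfUnity (C.ι n) X) (hρ : ρ.IsSubordinate (C.cover n).U),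
        LinearIndependent ℤ fun j : {j : ℕ // (j : ℕ∞) + 1 < k} =>
          C.fromLF 1 n ρ hρ (CoarseHomology.ProperRay.diffClass
            (r ⟨j, lt_of_le_of_lt le_self_add j.2⟩) (r ⟨j + 1, by exact_mod_cast j.2⟩)
            (hr _ _))) := by
  have hrays : ∃ r : {j : ℕ // (j : ℕ∞) < k} → CoarseHomology.ProperRay X,
      (∀ i j, r i 0 = r j 0) ∧ Function.Injective fun j => (r j).toEnd := by
    obtain ⟨e, he⟩ := CoarseHomology.exists_injective_of_card_eq hk
    obtain ⟨r, hr, hre⟩ := CoarseHomology.ProperRay.exists_rays_of_ends hX e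
    exact ⟨r, hr, fun i j hij => he ((hre i).symm.trans (Eq.trans hij (hre j)))⟩
  refine ⟨?_, hrays, fun r hr hinj n ρ hρ =>
    C.linearIndependent_fromLF_diffClass hX r hr hinj n ρ hρ⟩
  obtain ⟨r, hr, hinj⟩ := hrays
  -- The existence of the subgroup needs only one stage and one partition of unity; stage 0 is
  -- taken.
  obtain ⟨ρ, hρ⟩ := PartitionOfUnity.exists_isSubordinate isClosed_univ (C.cover 0).U
    (C.cover 0).isOpen (C.cover 0).iUnion_eq.ge
  exact CoarseHomology.exists_addSubgroup_of_linearIndependent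
    (C.linearIndependent_fromLF_diffClass hX r hr hinj 0 ρ hρ)
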